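/- All digraphs are finite and non-empty. A digraph is strong if every vertex can be reached from every vertex by a directed path, and semicomplete if any two distinct vertices are joined by at least one arc. Let $T$ be a digraph with vertices $u_1,\dots,u_t$ ($t\ge 2$) and let $H_1,\dots,H_t$ be digraphs with pairwise disjoint vertex sets. The composition $Q=T[H_1,\dots,H_t]$ is the digraph with vertex set $\bigcup_{i=1}^t V(H_i)$ and arc set $\bigcup_{i=1}^t A(H_i)\cup\{xy : x\in V(H_i),\ y\in V(H_j),\ u_iu_j\in A(T)\}$. A $k$-path subdigraph of $Q$ is a collection $\mathcal F$ of $k$ pairwise vertex-disjoint directed paths of $Q$ (a single vertex is a path); $V(\mathcal F)$ denotes the set of all vertices of these paths, and $\mathcal F$ is maximum if no $k$-path subdigraph of $Q$ has more vertices. Theorem. Let $Q=T[H_1,\dots,H_t]$ be strong, with $T$ semicomplete, and let $n=|V(Q)|$. For every $k\in\{1,\dots,n\}$ and every $i\in\{1,\dots,t\}$ there is an integer $n_{i,k}$ such that every maximum $k$-path subdigraph $\mathcal F$ of $Q$ satisfies $|V(H_i)\cap V(\mathcal F)|=n_{i,k}$, and no $k$-path subdigraph of $Q$ contains more than $n_{i,k}$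 vertices of $H_i$. Moreover, $n_{i,k}$ is the maximum number of vertices of $H_i$ that can be covered by a $k$-path subdigraph of $Q$; that is, if $\ell_{i,k}$ denotes this maximum, then every maximum $k$-path subdigraph of $Q$ covers exactly $\ell_{i,k}$ vertices of $H_i$. -/

import Mathlib

namespace SemicompleteComposition

/-- A digraph is semicomplete if any two distinct vertices are joined by at least one arc. -/
def IsSemicomplete {α : Type*} (D : Digraph α) : Prop :=
  ∀ x y : α, x ≠ y → D.Adj x y ∨ D.Adj y x

/-- A digraph is strong if from every vertex every vertex can be reached by a directed walk. -/
def IsStrong {α : Type*} (D : Digraph α) : Prop :=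
  ∀ x y : α, Relation.ReflTransGen D.Adj x y

/-- The composition `T[H_i : i ∈ ι]`: its vertex set is the disjoint union of the vertex sets of
the `H i`; its arcs are the arcs of every `H i`, and all arcs from the vertices of `H i` to the
vertices of `H j` for every arc `(i, j)` of `T`. -/
def composition {ι : Type*} {V : ι → Type*} (T : Digraph ι) (H : ∀ i, Digraph (V i)) :
    Digraph (Σ i, V i) where
  Adj p q :=
    (∃ (i : ι) (x y : V i), p = ⟨i, x⟩ ∧ q = ⟨i, y⟩ ∧ (H i).Adj x y) ∨ T.Adj p.1 q.1

/-- A (directed) path of `D`, given by the list of its vertices: at least one vertex, no vertex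
repeated, and an arc of `D` from each vertex to the next one. -/
def IsDipath {α : Type*} (D : Digraph α) (l : List α) : Prop :=
  l ≠ [] ∧ l.Nodup ∧ l.IsChain D.Adj

/-- A `k`-path subdigraph of `D`: `k` pairwise vertex-disjoint paths of `D`. -/
structure KPathSubdigraph {α : Type*} (D : Digraph α) (k : ℕ) where
  path : Fin k → List α
  isDipath : ∀ a, IsDipath D (path a)
  disjoint : ∀ a b, a ≠ b → List.Disjoint (path a) (path b)

/-- The set of the vertices of a `k`-path subdigraph. -/
def KPathSubdigraph.verts {α : Type*} {D : Digraph α} {k : ℕ} (F : KPathSubdigraph D k) :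
    Set α :=
  {v | ∃ a, v ∈ F.path a}

/-- A `k`-path subdigraph is maximum if no `k`-path subdigraph (with the same `k`) has more
vertices. -/
def KPathSubdigraph.IsMaximum {α : Type*} {D : Digraph α} {k : ℕ} (F : KPathSubdigraph D k) :
    Prop :=
  ∀ F' : KPathSubdigraph D k, F'.verts.ncard ≤ F.verts.ncard

/-- The set `V(H_i)`, as a set of vertices of the composition. -/
def part {ι : Type*} (V : ι → Type*) (i : ι) : Set (Σ i, V i) :=
  {p | p.1 = i}

end SemicompleteComposition

/-!
Cut every path of a `k`-path subdigraph `F` of the composition at the arcs between different parts.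
The pieces inside `V(H_v)` form a path system of `H_v` with, say, `m v` paths, so that `F` covers
at most as many vertices of `V(H_v)` as the best system of `m v` paths there, a number that does
not decrease with `m v` (`exists_optimal_pathSystemIn`). It is therefore enough to show that among
the vectors `m` arising in this way there is one that is largest in every coordinate at once.

* A vector `m` that arises satisfies, for every set `A` of vertices of `T`, the inequality
  `m(A) ≤ k + m(N⁺(A))`, since every piece in `A` ends its path or is followed by a piece in
  `N⁺(A)`; also `k ≤ m(V(T))`. This is `IsThroughput`.
* The inequality is equivalent to `m(A \ N⁺(A)) ≤ k + m(N⁺(A) \ A)`, and `A \ N⁺(A)` has at most one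
  element because `T` is semicomplete. So the left side is a single value `m b`, and the condition
  is preserved by pointwise maxima (`IsThroughput.sup`). Hence there is a greatest `m` subject to
  `m v ≤ |V(H_v)|`.
* Conversely every such `m` is realized. The inequalities are Hall's condition for the existence of
  a permutation of the pieces together with `k` separators that moves each element along an arc
  (`IsThroughput.exists_perm`). A cycle of that permutation without a separator can always be
  inserted into one with a separator, by semicompleteness (`IsThroughput.exists_perm_reached`).
  Cutting at the separators leaves `k` paths (`exists_lists_of_perm`), and an optimal path
  system of each part can be substituted for its pieces (`IsThroughput.exists_kPathSubdigraph`).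

The resulting `k`-path subdigraph covers the most vertices in every part simultaneously
(`exists_dominating_kPathSubdigraph`), so any maximum one has to agree with it in every part.

Apart from the end, a composition is treated as a digraph `D` on `α` with a map `col : α → ι` such
that the arcs between vertices of different colours `v`, `w` are exactly those prescribed by `T`.
Loops of `T` are allowed; the arcs they create inside a part count as arcs of that part.
-/

namespace SemicompleteComposition

/-! ### Throughput vectors -/

open scoped Classical in
/-- The out-neighbourhood of a set `A` of vertices, loops being ignored. -/
noncomputable def outNbrs {ι : Type*} [Fintype ι] (T : Digraph ι) (A : Finset ι) : Finset ι :=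
  Finset.univ.filter fun w => ∃ v ∈ A, T.Adj v w ∧ v ≠ w

/-- The conditions on `m` under which `k` walks of `T` can visit every vertex `v` exactly `m v` times
in total: Hall's condition for choosing the successor of every visit, where `k` of the visits may
have none, and the requirement that none of the walks is empty. -/
structure IsThroughput {ι : Type*} [Fintype ι] (T : Digraph ι) (k : ℕ) (m : ι → ℕ) : Prop where
  sum_le : ∀ A : Finset ι, ∑ v ∈ A, m v ≤ k + ∑ w ∈ outNbrs T A, m w
  le_sum : k ≤ ∑ v, m v

theorem mem_outNbrs {ι : Type*} [Fintype ι] {T : Digraph ι} {A : Finset ι} {w : ι} :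
    w ∈ outNbrs T A ↔ ∃ v ∈ A, T.Adj v w ∧ v ≠ w := by
  simp [outNbrs]

/-- Semicompleteness enters through the fact that `A \ outNbrs T A` has at most one element. -/
theorem IsThroughput.sup {ι : Type*} [Fintype ι] {T : Digraph ι} (hT : IsSemicomplete T) {k : ℕ}
    {m m' : ι → ℕ} (h : IsThroughput T k m) (h' : IsThroughput T k m') :
    IsThroughput T k (m ⊔ m') := by
  classical
  refine ⟨fun A => ?_, h.le_sum.trans (Finset.sum_le_sum fun v _ => le_sup_left)⟩
  set N := outNbrs T A with hN
  -- the common part of `A` and `N` cancels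
  have hcut : ∀ f : ι → ℕ, (∑ v ∈ A, f v ≤ k + ∑ w ∈ N, f w) ↔
      ∑ v ∈ A \ N, f v ≤ k + ∑ w ∈ N \ A, f w := by
    intro f
    rw [← Finset.sum_inter_add_sum_sdiff A N f, ← Finset.sum_inter_add_sum_sdiff N A f,
      Finset.inter_comm N A]
    omega
  have hsub : ∀ x ∈ A \ N, ∀ y ∈ A \ N, x = y := by
    intro x hx y hy
    by_contra hxy
    simp only [Finset.mem_sdiff, hN, mem_outNbrs] at hx hy
    rcases hT x y hxy with ha | ha
    · exact hy.2 ⟨x, hx.1, ha, hxy⟩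
    · exact hx.2 ⟨y, hy.1, ha, Ne.symm hxy⟩
  have h1 := (hcut m).1 (h.sum_le A)
  have h2 := (hcut m').1 (h'.sum_le A)
  rw [hcut]
  have e1 : ∑ w ∈ N \ A, m w ≤ ∑ w ∈ N \ A, (m ⊔ m') w :=
    Finset.sum_le_sum fun v _ => le_sup_left
  have e2 : ∑ w ∈ N \ A, m' w ≤ ∑ w ∈ N \ A, (m ⊔ m') w :=
    Finset.sum_le_sum fun v _ => le_sup_right
  rcases (A \ N).eq_empty_or_nonempty with he | ⟨b, hb⟩
  · simp [he]
  · have hs : A \ N = {b} := Finset.eq_singleton_iff_unique_mem.2 ⟨hb, fun x hx => hsub x hx b hb⟩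
    rw [hs, Finset.sum_singleton] at h1 h2 ⊢
    simp only [Pi.sup_apply]
    rcases le_total (m b) (m' b) with hle | hle
    · rw [sup_eq_right.2 hle]; exact h2.trans (by simpa using e2)
    · rw [sup_eq_left.2 hle]; exact h1.trans (by simpa using e1)

/-! ### Permutations of visits and separators -/

/-- The set of visits, `m v` of them for each vertex `v`, is extended by `k` separators `Sum.inr s`.
A visit may be followed by a visit to an out-neighbour or by a separator, and a separator by any
visit, but not by a separator. -/
def Step {ι : Type*} (T : Digraph ι) (k : ℕ) (m : ι → ℕ) :
    (Σ v, Fin (m v)) ⊕ Fin k → (Σ v, Fin (m v)) ⊕ Fin k → Prop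
  | .inl x, .inl y => T.Adj x.1 y.1 ∧ x.1 ≠ y.1
  | .inl _, .inr _ => True
  | .inr _, .inl _ => True
  | .inr _, .inr _ => False

/-- Hall's marriage theorem, applied to `Step T k m`. -/
theorem IsThroughput.exists_perm {ι : Type*} [Fintype ι] {T : Digraph ι} {k : ℕ} {m : ι → ℕ}
    (h : IsThroughput T k m) :
    ∃ f : Equiv.Perm ((Σ v, Fin (m v)) ⊕ Fin k), ∀ x, Step T k m x (f x) := by
  classical
  have hcard : ∀ B : Finset ι, (Finset.univ.filter
      (fun x : Σ v, Fin (m v) => x.1 ∈ B)).card = ∑ v ∈ B, m v := by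
    intro B
    have : Finset.univ.filter (fun x : Σ v, Fin (m v) => x.1 ∈ B) =
        B.sigma fun v => (Finset.univ : Finset (Fin (m v))) := by
      ext x; simp
    rw [this, Finset.card_sigma]; simp
  obtain ⟨f, hinj, hf⟩ := (Fintype.all_card_le_filter_rel_iff_exists_injective (Step T k m)).1 (by
    intro 𝒜
    set N := Finset.univ.filter fun y => ∃ x ∈ 𝒜, Step T k m x y with hN
    have hcardsum : ∀ S : Finset ((Σ v, Fin (m v)) ⊕ Fin k),
        S.card = S.toLeft.card + S.toRight.card := fun S => S.card_toLeft_add_card_toRight.symm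
    have hr : 𝒜.toRight.card ≤ k := by simpa using Finset.card_le_univ 𝒜.toRight
    have hNr : 𝒜.toLeft.Nonempty → N.toRight.card = k := by
      rintro ⟨x, hx⟩
      have : N.toRight = Finset.univ := by
        ext s
        simp only [Finset.mem_toRight, hN, Finset.mem_filter, Finset.mem_univ, true_and, iff_true]
        exact ⟨.inl x, by simpa using hx, trivial⟩
      simp [this]
    have hNl : 𝒜.toRight.Nonempty → N.toLeft.card = ∑ v, m v := by
      rintro ⟨s, hs⟩
      have : N.toLeft = Finset.univ := by
        ext x
        simp only [Finset.mem_toLeft, hN, Finset.mem_filter, Finset.mem_univ, true_and, iff_true]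
        exact ⟨.inr s, by simpa using hs, trivial⟩
      simp [this]
    rw [hcardsum 𝒜, hcardsum N]
    rcases 𝒜.toRight.eq_empty_or_nonempty with he | hne
    · rcases 𝒜.toLeft.eq_empty_or_nonempty with he' | hne'
      · simp [he, he']
      · rw [hNr hne', he]
        set A := 𝒜.toLeft.image Sigma.fst with hA
        have h1 : 𝒜.toLeft.card ≤ ∑ v ∈ A, m v := by
          rw [← hcard]
          refine Finset.card_le_card fun x hx => ?_
          simpa [hA] using ⟨x.2, by simpa using hx⟩
        have h2 : ∑ v ∈ outNbrs T A, m v ≤ N.toLeft.card := by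
          rw [← hcard]
          refine Finset.card_le_card fun y hy => ?_
          obtain ⟨v, hv, hvy⟩ := mem_outNbrs.1 (Finset.mem_filter.1 hy).2
          obtain ⟨x, hx, rfl⟩ := Finset.mem_image.1 hv
          simp only [Finset.mem_toLeft, hN, Finset.mem_filter, Finset.mem_univ, true_and]
          exact ⟨.inl x, by simpa using hx, hvy⟩
        have := h.sum_le A
        simp only [Finset.card_empty]
        omega
    · rw [hNl hne]
      rcases 𝒜.toLeft.eq_empty_or_nonempty with he' | hne'
      · have := h.le_sum
        rw [he', Finset.card_empty]; omega
      · rw [hNr hne']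
        have : 𝒜.toLeft.card ≤ ∑ v, m v := by simpa using Finset.card_le_univ 𝒜.toLeft
        omega)
  exact ⟨Equiv.ofBijective f (Finite.injective_iff_bijective.1 hinj), hf⟩

/-- The elements reached from `γ` by iterating `f`; for finite types, the union of those cycles of
`f` that contain an element of `γ`. -/
def Reached {β γ : Type*} (f : Equiv.Perm (β ⊕ γ)) : Set (β ⊕ γ) :=
  {y | ∃ s n, f^[n] (.inr s) = y}

theorem apply_mem_reached {β γ : Type*} {f : Equiv.Perm (β ⊕ γ)} {y : β ⊕ γ}
    (hy : y ∈ Reached f) : f y ∈ Reached f := by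
  obtain ⟨s, n, rfl⟩ := hy
  exact ⟨s, n + 1, Function.iterate_succ_apply' f n _⟩

theorem exists_iterate_eq_self {β : Type*} [Finite β] (f : Equiv.Perm β) (x : β) :
    ∃ n, 0 < n ∧ f^[n] x = x := by
  refine ⟨orderOf f, orderOf_pos f, ?_⟩
  rw [← Equiv.Perm.coe_pow, pow_orderOf_eq_one]; rfl

theorem mem_reached_of_apply {β γ : Type*} [Finite β] [Finite γ] {f : Equiv.Perm (β ⊕ γ)}
    {y : β ⊕ γ} (hy : f y ∈ Reached f) : y ∈ Reached f := by
  obtain ⟨n, hn, h⟩ := exists_iterate_eq_self f y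
  obtain ⟨j, rfl⟩ := Nat.exists_eq_succ_of_ne_zero hn.ne'
  obtain ⟨s, i, hi⟩ := hy
  refine ⟨s, j + i, ?_⟩
  rw [Function.iterate_add_apply, hi]
  exact h

/-- Interchanging the successors of `x` and `c`, which lie on different cycles, joins these cycles. -/
theorem reached_ssubset_mul_swap {β γ : Type*} [Finite β] [Finite γ] [DecidableEq (β ⊕ γ)]
    {f : Equiv.Perm (β ⊕ γ)} {x c : β ⊕ γ} (hx : x ∈ Reached f) (hc : c ∉ Reached f) :
    Reached f ⊂ Reached (f * Equiv.swap x c) := by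
  set g := f * Equiv.swap x c with hg
  have gx : g x = f c := by simp [hg]
  have gc : g c = f x := by simp [hg]
  have go : ∀ y, y ≠ x → y ≠ c → g y = f y := fun y h1 h2 => by
    simp [hg, Equiv.swap_apply_of_ne_of_ne h1 h2]
  have hnot : ∀ j, f^[j] c ∉ Reached f := by
    intro j
    induction j with
    | zero => exact hc
    | succ j ih =>
      rw [Function.iterate_succ_apply']
      exact fun h => ih (mem_reached_of_apply h)
  -- once `x` is reached, the whole cycle of `c` is
  have horb : x ∈ Reached g → ∀ j, f^[j] (f c) ∈ Reached g := by
    intro h j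
    induction j with
    | zero => exact gx ▸ apply_mem_reached h
    | succ j ih =>
      rw [Function.iterate_succ_apply']
      by_cases hj : f^[j] (f c) = c
      · rw [hj, ← gx]; exact apply_mem_reached h
      · rw [← go _ ?_ hj]
        · exact apply_mem_reached ih
        · intro h'
          exact hnot (j + 1) (by rw [Function.iterate_succ_apply, h']; exact hx)
  have hcg : x ∈ Reached g → c ∈ Reached g := by
    intro h
    obtain ⟨n, hn, hnc⟩ := exists_iterate_eq_self f c
    obtain ⟨j, rfl⟩ := Nat.exists_eq_succ_of_ne_zero hn.ne'
    have := horb h j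
    rwa [← Function.iterate_succ_apply, hnc] at this
  have hsub : Reached f ⊆ Reached g := by
    rintro _ ⟨s, n, rfl⟩
    induction n with
    | zero => exact ⟨s, 0, rfl⟩
    | succ n ih =>
      rw [Function.iterate_succ_apply']
      by_cases hx' : f^[n] (.inr s) = x
      · rw [hx', ← gc]
        exact apply_mem_reached (hcg (hx' ▸ ih))
      · rw [← go _ hx' fun h => hc ⟨s, n, h⟩]
        exact apply_mem_reached ih
  exact ⟨hsub, fun h => hc (h (hcg (hsub hx)))⟩

/-- A permutation with as many elements as possible on cycles with a separator leaves none on other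
cycles. Otherwise, let `C` be the set of the elements on other cycles. Starting at a separator, each
element that can be followed by all of `C` has a successor with the same property: since no
interchange of successors is possible, that successor has no arc from `C`. Going once around the
cycle gives a contradiction at the return to the separator, which may follow everything. -/
theorem IsThroughput.exists_perm_reached {ι : Type*} [Fintype ι] {T : Digraph ι}
    (hT : IsSemicomplete T) {k : ℕ} (hk : 1 ≤ k) {m : ι → ℕ} (h : IsThroughput T k m) :
    ∃ f : Equiv.Perm ((Σ v, Fin (m v)) ⊕ Fin k), (∀ x, Step T k m x (f x)) ∧
      ∀ y, y ∈ Reached f := by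
  classical
  obtain ⟨f, hf, hmax⟩ := Set.exists_max_image
    {f : Equiv.Perm ((Σ v, Fin (m v)) ⊕ Fin k) | ∀ x, Step T k m x (f x)}
    (fun f => (Reached f).ncard) (Set.toFinite _) h.exists_perm
  refine ⟨f, hf, ?_⟩
  by_contra! hC
  have hf : ∀ x, Step T k m x (f x) := hf
  -- by maximality, no cycle without separator can be inserted
  have hswap : ∀ x ∈ Reached f, ∀ c ∉ Reached f, Step T k m x (f c) →
      ¬ Step T k m c (f x) := by
    intro x hx c hc h1 h2
    refine absurd (Set.ncard_lt_ncard (reached_ssubset_mul_swap hx hc) (Set.toFinite _))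
      (not_lt.2 (hmax _ fun y => ?_))
    by_cases hyx : y = x
    · simpa [hyx] using h1
    by_cases hyc : y = c
    · simpa [hyc] using h2
    · simpa [Equiv.swap_apply_of_ne_of_ne hyx hyc] using hf y
  have hC' : ∀ c ∉ Reached f, f c ∉ Reached f := fun c hc h => hc (mem_reached_of_apply h)
  obtain ⟨c₀, hc₀⟩ := hC
  let s : Fin k := ⟨0, hk⟩
  have hinl : ∀ c ∉ Reached f, ∃ z, c = .inl z := by
    rintro (z | s') hc
    · exact ⟨z, rfl⟩
    · exact absurd ⟨s', 0, rfl⟩ hc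
  have key : ∀ n, ∀ c ∉ Reached f, Step T k m (f^[n] (.inr s)) c := by
    intro n
    induction n with
    | zero =>
      intro c hc
      obtain ⟨z, rfl⟩ := hinl c hc
      trivial
    | succ n ih =>
      intro c hc
      set x := f^[n] (.inr s) with hx
      have hxr : x ∈ Reached f := ⟨s, n, rfl⟩
      rw [Function.iterate_succ_apply', ← hx]
      have hno : ∀ c ∉ Reached f, ¬ Step T k m c (f x) := fun c hc =>
        hswap x hxr c hc (ih _ (hC' c hc))
      have hpre : f (f.symm c) = c := f.apply_symm_apply c
      have hcs : f.symm c ∉ Reached f := fun h => hc (hpre ▸ apply_mem_reached h)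
      have h1 := hno c hc
      have h2 := hno _ hcs
      have h3 := hf (f.symm c)
      rw [hpre] at h3
      obtain ⟨z, rfl⟩ := hinl c hc
      obtain ⟨z', hz'⟩ := hinl _ hcs
      rw [hz'] at h2 h3
      cases hy : f x with
      | inr s' => trivial
      | inl y =>
        rw [hy] at h1 h2
        simp only [Step] at h1 h2 h3 ⊢
        -- `y` cannot have the same first component as `z`, as the predecessor of `z` has no
        -- arc to `y`
        have hne : y.1 ≠ z.1 := fun he => h2 (he ▸ h3)
        refine ⟨(hT _ _ hne).resolve_right fun ha => h1 ⟨ha, hne.symm⟩, hne⟩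
  obtain ⟨n, hn, hns⟩ := exists_iterate_eq_self f (.inr s)
  obtain ⟨j, rfl⟩ := Nat.exists_eq_succ_of_ne_zero hn.ne'
  rw [Function.iterate_succ_apply'] at hns
  refine hswap _ ⟨s, j, rfl⟩ c₀ hc₀ (key j _ (hC' c₀ hc₀)) ?_
  rw [hns]
  obtain ⟨z, rfl⟩ := hinl c₀ hc₀
  trivial

/-- Cutting the cycles of `f` at the elements of `γ` gives one list for each element of `γ`. -/
theorem exists_lists_of_perm {β γ : Type*} [Finite β] [Finite γ] (f : Equiv.Perm (β ⊕ γ))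
    (hf : ∀ y, y ∈ Reached f) (hs : ∀ s s' : γ, f (.inr s) ≠ .inr s') :
    ∃ p : γ → List β, (∀ s, p s ≠ [] ∧ (p s).Nodup ∧
        (p s).IsChain fun x y => f (.inl x) = .inl y) ∧
      (∀ s s', s ≠ s' → List.Disjoint (p s) (p s')) ∧ ∀ x, ∃ s, x ∈ p s := by
  classical
  have hex : ∀ s : γ, ∃ n, ∃ s' : γ, f^[n + 1] (.inr s) = .inr s' := by
    intro s
    obtain ⟨n, hn, h⟩ := exists_iterate_eq_self f (.inr s)
    obtain ⟨j, rfl⟩ := Nat.exists_eq_succ_of_ne_zero hn.ne'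
    exact ⟨j, s, h⟩
  -- `N s + 1` is the number of steps from `s` to the next element of `γ`
  let N : γ → ℕ := fun s => Nat.find (hex s)
  have hN : ∀ s, ∃ s', f^[N s + 1] (.inr s) = .inr s' := fun s => Nat.find_spec (hex s)
  have hlt : ∀ s s' n, n < N s → f^[n + 1] (.inr s) ≠ .inr s' := fun s s' n hn he =>
    Nat.find_min (hex s) hn ⟨s', he⟩
  have hlist : ∀ s, ∃ l : List β, l.map .inl =
      (List.range (N s)).map fun n => f^[n + 1] (.inr s) := by
    intro s
    have : (List.range (N s)).map (fun n => f^[n + 1] (.inr s)) ∈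
        Set.range (List.map (Sum.inl : β → β ⊕ γ)) := by
      rw [Set.range_list_map]
      intro y hy
      obtain ⟨n, hn, rfl⟩ := List.mem_map.1 hy
      rcases he : f^[n + 1] (.inr s) with z | s'
      · exact ⟨z, rfl⟩
      · exact absurd he (hlt s s' n (List.mem_range.1 hn))
    exact this
  choose p hp using hlist
  have hmem : ∀ s x, x ∈ p s ↔ ∃ n < N s, f^[n + 1] (.inr s) = .inl x := by
    intro s x
    rw [← List.mem_map_of_injective (f := (Sum.inl : β → β ⊕ γ)) Sum.inl_injective, hp]
    simp only [List.mem_map, List.mem_range]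
  have hinj : ∀ s s' n j, f^[n + j + 1] (.inr s) = f^[n + 1] (.inr s') →
      f^[j] (.inr s) = .inr s' := by
    intro s s' n j he
    refine (f.injective.iterate (n + 1)) ?_
    rw [← he, ← Function.iterate_add_apply, Nat.add_right_comm]
  refine ⟨p, fun s => ⟨?_, ?_, ?_⟩, ?_, ?_⟩
  · intro h0
    have h1 := hp s
    rw [h0, List.map_nil, eq_comm, List.map_eq_nil_iff, List.range_eq_nil] at h1
    obtain ⟨s', h2⟩ := hN s
    rw [h1] at h2
    exact hs s s' h2
  · refine List.Nodup.of_map (Sum.inl : β → β ⊕ γ) ?_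
    rw [hp, List.nodup_map_iff_inj_on List.nodup_range]
    have aux : ∀ a < N s, ∀ b < N s, a ≤ b → f^[a + 1] (.inr s) = f^[b + 1] (.inr s) → a = b := by
      intro a ha b hb hab he
      obtain ⟨j, rfl⟩ := Nat.exists_eq_add_of_le hab
      have := hinj s s a j he.symm
      cases j with
      | zero => rfl
      | succ j => exact absurd this (hlt s s j (by omega))
    intro a ha b hb he
    rw [List.mem_range] at ha hb
    rcases le_total a b with hab | hab
    · exact aux a ha b hb hab he
    · exact (aux b hb a ha hab he.symm).symm
  · have h1 : ((p s).map (Sum.inl : β → β ⊕ γ)).IsChain fun x y => f x = y := by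
      rw [hp, List.isChain_map, List.isChain_iff_getElem]
      intro i hi
      simp only [List.getElem_range]
      exact (Function.iterate_succ_apply' f _ _).symm
    rwa [List.isChain_map] at h1
  · have aux : ∀ s s' a b x, s ≠ s' → a ≤ b → b < N s → f^[a + 1] (.inr s') = .inl x →
        f^[b + 1] (.inr s) = .inl x → False := by
      intro s s' a b x hne hab hb h1 h2
      obtain ⟨j, rfl⟩ := Nat.exists_eq_add_of_le hab
      have := hinj s s' a j (h2.trans h1.symm)
      cases j with
      | zero => exact hne (Sum.inr_injective this)
      | succ j => exact absurd this (hlt s s' j (by omega))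
    intro s s' hne x hx hx'
    obtain ⟨a, ha, h1⟩ := (hmem _ _).1 hx
    obtain ⟨b, hb, h2⟩ := (hmem _ _).1 hx'
    rcases le_total a b with hab | hab
    · exact aux s' s a b x hne.symm hab hb h1 h2
    · exact aux s s' b a x hne hab ha h2 h1
  · intro x
    have hx : ∃ n s, f^[n] (.inr s) = .inl x := by
      obtain ⟨s, n, h⟩ := hf (.inl x)
      exact ⟨n, s, h⟩
    -- the last element of `γ` before `x`
    obtain ⟨s, h⟩ := Nat.find_spec hx
    have hmin : ∀ j < Nat.find hx, ∀ s, f^[j] (.inr s) ≠ .inl x := fun j hj s he =>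
      Nat.find_min hx hj ⟨s, he⟩
    generalize Nat.find hx = n at h hmin
    cases n with
    | zero => simp at h
    | succ n =>
      refine ⟨s, (hmem s x).2 ⟨n, ?_, h⟩⟩
      by_contra hge
      obtain ⟨s', hs'⟩ := hN s
      obtain ⟨j, rfl⟩ := Nat.exists_eq_add_of_le (not_lt.1 hge)
      refine hmin j (by omega) s' ?_
      rw [← hs', ← Function.iterate_add_apply, ← h, Nat.add_comm j, Nat.add_right_comm]


/-! ### Path systems inside a set of vertices -/

/-- `R` lists pairwise disjoint paths of `D` all of whose vertices lie in `S`. -/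
structure IsPathSystemIn {α : Type*} (D : Digraph α) (S : Set α) (R : List (List α)) : Prop where
  isDipath : ∀ l ∈ R, IsDipath D l
  nodup : R.flatten.Nodup
  subset : ∀ x ∈ R.flatten, x ∈ S

theorem ncard_setOf_mem_of_nodup {α : Type*} {l : List α} (h : l.Nodup) :
    {x | x ∈ l}.ncard = l.length := by
  classical
  rw [← List.toFinset_card_of_nodup h, ← Set.ncard_coe_finset]
  congr 1; ext; simp

theorem IsPathSystemIn.length_flatten_le {α : Type*} [Finite α] {D : Digraph α} {S : Set α}
    {R : List (List α)} (h : IsPathSystemIn D S R) : R.flatten.length ≤ S.ncard := by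
  rw [← ncard_setOf_mem_of_nodup h.nodup]
  exact Set.ncard_le_ncard h.subset (Set.toFinite _)

theorem length_le_length_flatten {α : Type*} {R : List (List α)} (h : ∀ l ∈ R, l ≠ []) :
    R.length ≤ R.flatten.length := by
  induction R with
  | nil => simp
  | cons l R ih =>
    have h1 := ih fun l hl => h l (List.mem_cons_of_mem _ hl)
    have h2 := List.length_pos_iff.2 (h l (by simp))
    simp only [List.flatten_cons, List.length_append, List.length_cons]
    omega

theorem length_flatten_le_length {α : Type*} {R : List (List α)} (h : ∀ l ∈ R, l.length ≤ 1) :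
    R.flatten.length ≤ R.length := by
  induction R with
  | nil => simp
  | cons l R ih =>
    have h1 := ih fun l hl => h l (List.mem_cons_of_mem _ hl)
    have h2 := h l (by simp)
    simp only [List.flatten_cons, List.length_append, List.length_cons]
    omega

theorem IsPathSystemIn.exists_succ {α : Type*} [Finite α] {D : Digraph α} {S : Set α}
    {R : List (List α)} (h : IsPathSystemIn D S R) (hlt : R.length < S.ncard) :
    ∃ R', IsPathSystemIn D S R' ∧ R'.length = R.length + 1 ∧
      R.flatten.length ≤ R'.flatten.length := by
  by_cases hx : ∃ x ∈ S, x ∉ R.flatten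
  · obtain ⟨x, hxS, hx⟩ := hx
    refine ⟨[x] :: R, ⟨?_, ?_, ?_⟩, rfl, by simp⟩
    · intro l hl
      rcases List.mem_cons.1 hl with rfl | hl
      · exact ⟨by simp, by simp, by simp⟩
      · exact h.isDipath l hl
    · exact List.nodup_cons.2 ⟨hx, h.nodup⟩
    · intro y hy
      rcases List.mem_cons.1 hy with rfl | hy
      · exact hxS
      · exact h.subset y hy
  · -- every vertex of `S` is covered, so some path has two vertices and can be cut
    push Not at hx
    have hS : S.ncard = R.flatten.length := by
      rw [← ncard_setOf_mem_of_nodup h.nodup]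
      congr 1
      exact Set.Subset.antisymm hx h.subset
    have hlong : ∃ l ∈ R, 1 < l.length := by
      by_contra! hle
      have := length_flatten_le_length hle
      omega
    obtain ⟨l, hl, hlen⟩ := hlong
    obtain ⟨L₁, L₂, rfl⟩ := List.append_of_mem hl
    match l, hlen with
    | x :: y :: t, _ =>
      have hd := h.isDipath _ hl
      have hflat : (L₁ ++ [x] :: (y :: t) :: L₂).flatten = (L₁ ++ (x :: y :: t) :: L₂).flatten := by
        simp
      refine ⟨L₁ ++ [x] :: (y :: t) :: L₂, ⟨?_, hflat ▸ h.nodup, hflat ▸ h.subset⟩, ?_,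
        hflat ▸ le_rfl⟩
      · intro l hl
        simp only [List.mem_append, List.mem_cons] at hl
        rcases hl with hl | rfl | rfl | hl
        · exact h.isDipath l (by simp [hl])
        · exact ⟨by simp, by simp, by simp⟩
        · exact ⟨by simp, hd.2.1.of_cons, hd.2.2.tail⟩
        · exact h.isDipath l (by simp [hl])
      · simp; omega

theorem IsPathSystemIn.exists_length_eq {α : Type*} [Finite α] {D : Digraph α} {S : Set α}
    {R : List (List α)} (h : IsPathSystemIn D S R) {m : ℕ} (hRm : R.length ≤ m)
    (hm : m ≤ S.ncard) :
    ∃ R', IsPathSystemIn D S R' ∧ R'.length = m ∧ R.flatten.length ≤ R'.flatten.length := by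
  induction m, hRm using Nat.le_induction with
  | base => exact ⟨R, h, rfl, le_rfl⟩
  | succ m _ ih =>
    obtain ⟨R₁, h₁, rfl, hle₁⟩ := ih (by omega)
    obtain ⟨R₂, h₂, hl₂, hle₂⟩ := h₁.exists_succ (by omega)
    exact ⟨R₂, h₂, hl₂, hle₁.trans hle₂⟩

theorem exists_optimal_pathSystemIn {α : Type*} [Finite α] (D : Digraph α) (S : Set α) {m : ℕ}
    (hm : m ≤ S.ncard) :
    ∃ R, IsPathSystemIn D S R ∧ R.length = m ∧
      ∀ R', IsPathSystemIn D S R' → R'.length ≤ m → R'.flatten.length ≤ R.flatten.length := by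
  have hnil : IsPathSystemIn D S [] := ⟨by simp, by simp, by simp⟩
  obtain ⟨R₀, h₀, hl₀, -⟩ := hnil.exists_length_eq (Nat.zero_le m) hm
  let X : Set ℕ := {n | ∃ R, IsPathSystemIn D S R ∧ R.length = m ∧ R.flatten.length = n}
  have hbdd : BddAbove X := ⟨S.ncard, by rintro _ ⟨R, hR, -, rfl⟩; exact hR.length_flatten_le⟩
  obtain ⟨R, hR, hl, he⟩ : sSup X ∈ X := Nat.sSup_mem ⟨_, R₀, h₀, hl₀, rfl⟩ hbdd
  refine ⟨R, hR, hl, fun R' h' hle => ?_⟩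
  obtain ⟨R'', h'', hl'', hle''⟩ := h'.exists_length_eq hle hm
  exact hle''.trans (he ▸ le_csSup hbdd ⟨R'', h'', hl'', rfl⟩)

/-! ### From path subdigraphs to throughput vectors -/

/-- A walk of `D` is a concatenation of nonempty one-coloured walks, each listed with its colour, such
that the colours form a walk of `T` without loops. -/
theorem exists_monochromatic_decomposition {ι α : Type*} {T : Digraph ι} {D : Digraph α}
    {col : α → ι} (hD : ∀ x y, col x ≠ col y → (D.Adj x y ↔ T.Adj (col x) (col y)))
    {l : List α} (hl : l.IsChain D.Adj) :
    ∃ L : List (ι × List α), (L.map Prod.snd).flatten = l ∧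
      (∀ q ∈ L, q.2 ≠ [] ∧ q.2.IsChain D.Adj ∧ ∀ x ∈ q.2, col x = q.1) ∧
      (L.map Prod.fst).IsChain fun v w => T.Adj v w ∧ v ≠ w := by
  classical
  induction l with
  | nil => exact ⟨[], by simp⟩
  | cons x l ih =>
    obtain ⟨L, rfl, hq, hc⟩ := ih hl.tail
    match L, hq, hc, hl with
    | [], _, _, _ => exact ⟨[(col x, [x])], by simp⟩
    | (v, []) :: L', hq, _, _ => exact absurd rfl (hq (v, []) (by simp)).1
    | (v, y :: q) :: L', hq, hc, hl =>
      have hxy : D.Adj x y := by simpa using hl.rel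
      obtain ⟨-, hqc, hqv⟩ := hq (v, y :: q) (by simp)
      have hyv : col y = v := hqv y (by simp)
      by_cases hx : col x = v
      · refine ⟨(v, x :: y :: q) :: L', by simp, ?_, by simpa using hc⟩
        intro r hr
        rcases List.mem_cons.1 hr with rfl | hr
        · refine ⟨by simp, hqc.cons_cons hxy, ?_⟩
          intro z hz
          rcases List.mem_cons.1 hz with rfl | hz
          · exact hx
          · exact hqv z hz
        · exact hq r (List.mem_cons_of_mem _ hr)
      · refine ⟨(col x, [x]) :: (v, y :: q) :: L', by simp, ?_, ?_⟩
        · intro r hr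
          rcases List.mem_cons.1 hr with rfl | hr
          · simp
          · exact hq r hr
        · subst hyv
          simp only [List.map_cons] at hc ⊢
          exact hc.cons_cons ⟨(hD _ _ hx).1 hxy, hx⟩

theorem countP_le_succ_countP_outNbrs {ι : Type*} [Fintype ι] [DecidableEq ι] {T : Digraph ι}
    (A : Finset ι) {l : List ι} (hl : l.IsChain fun v w => T.Adj v w ∧ v ≠ w) :
    l.countP (· ∈ A) ≤ 1 + l.countP (· ∈ outNbrs T A) := by
  -- every entry in `A` but the last is charged to the next entry, so the first entry is not needed
  -- on the right
  have key : ∀ (t : List ι) (a : ι), (a :: t).IsChain (fun v w => T.Adj v w ∧ v ≠ w) →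
      (a :: t).countP (· ∈ A) ≤ 1 + t.countP (· ∈ outNbrs T A) := by
    intro t
    induction t with
    | nil => intro a _; exact List.countP_le_length
    | cons b t ih =>
      intro a h
      have h1 := ih b h.tail
      have h2 : a ∈ A → b ∈ outNbrs T A := fun ha =>
        mem_outNbrs.2 ⟨a, ha, h.rel.1, h.rel.2⟩
      rw [List.countP_cons, List.countP_cons (a := b) (l := t) (p := (· ∈ outNbrs T A))]
      by_cases ha : a ∈ A
      · simp [ha, h2 ha]; omega
      · simp [ha]; omega
  cases l with
  | nil => simp
  | cons a t =>
    refine (key t a hl).trans ?_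
    rw [List.countP_cons]; omega

theorem sum_count_eq_countP {ι : Type*} [DecidableEq ι] (A : Finset ι) (l : List ι) :
    ∑ v ∈ A, l.count v = l.countP (· ∈ A) := by
  induction l with
  | nil => simp
  | cons a l ih =>
    simp only [List.count_cons, List.countP_cons, Finset.sum_add_distrib, ih]
    simp

/-- The numbers of visits of finitely many nonempty walks of `T` form a throughput vector. -/
theorem isThroughput_count {ι : Type*} [Fintype ι] [DecidableEq ι] {T : Digraph ι}
    {C : List (List ι)} (hne : ∀ c ∈ C, c ≠ [])
    (hC : ∀ c ∈ C, c.IsChain fun v w => T.Adj v w ∧ v ≠ w) :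
    IsThroughput T C.length fun v => C.flatten.count v := by
  refine ⟨fun A => ?_, ?_⟩
  · rw [sum_count_eq_countP, sum_count_eq_countP]
    clear hne
    induction C with
    | nil => simp
    | cons c C ih =>
      have h1 := ih fun c hc => hC c (List.mem_cons_of_mem _ hc)
      have h2 := countP_le_succ_countP_outNbrs A (hC c (by simp))
      simp only [List.flatten_cons, List.countP_append, List.length_cons]
      omega
  · rw [sum_count_eq_countP]
    simpa using length_le_length_flatten hne

theorem KPathSubdigraph.nodup_flatten {α : Type*} {D : Digraph α} {k : ℕ}
    (F : KPathSubdigraph D k) : (List.ofFn F.path).flatten.Nodup := by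
  rw [List.nodup_flatten]
  refine ⟨?_, ?_⟩
  · intro l hl
    obtain ⟨a, rfl⟩ := (List.mem_ofFn' _ _).1 hl
    exact (F.isDipath a).2.1
  · rw [List.pairwise_ofFn]
    exact fun a b hab => F.disjoint a b hab.ne

/-- Here `m v` is the number of pieces of colour `v` into which the paths of `F` decompose, and `R`
lists these pieces. -/
theorem KPathSubdigraph.exists_isThroughput {ι α : Type*} [Fintype ι] {T : Digraph ι}
    {D : Digraph α} {col : α → ι}
    (hD : ∀ x y, col x ≠ col y → (D.Adj x y ↔ T.Adj (col x) (col y))) {k : ℕ}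
    (F : KPathSubdigraph D k) :
    ∃ m : ι → ℕ, IsThroughput T k m ∧ ∀ v, ∃ R, IsPathSystemIn D {x | col x = v} R ∧
      R.length = m v ∧ ({x | col x = v} ∩ F.verts).ncard = R.flatten.length := by
  classical
  choose L hflat hL hchain using fun a =>
    exists_monochromatic_decomposition hD (F.isDipath a).2.2
  -- `C` lists the colour sequences of the paths, `Q` all pieces with their colours
  let C : List (List ι) := List.ofFn fun a => (L a).map Prod.fst
  let Q : List (ι × List α) := (List.ofFn L).flatten
  have hQ : ∀ q ∈ Q, ∃ a, q ∈ L a := by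
    intro q hq
    obtain ⟨l, hl, hql⟩ := List.mem_flatten.1 hq
    obtain ⟨a, rfl⟩ := (List.mem_ofFn' _ _).1 hl
    exact ⟨a, hql⟩
  have hCQ : C.flatten = Q.map Prod.fst := by
    simp only [C, Q, List.map_flatten, List.map_ofFn]; rfl
  have hQF : (Q.map Prod.snd).flatten = (List.ofFn F.path).flatten := by
    have : (fun a => ((L a).map Prod.snd).flatten) = F.path := funext hflat
    rw [← this]
    simp only [Q, List.map_flatten, List.map_ofFn, List.flatten_flatten]; rfl
  have hnodup : (Q.map Prod.snd).flatten.Nodup := hQF ▸ F.nodup_flatten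
  refine ⟨fun v => C.flatten.count v, ?_, ?_⟩
  · have := isThroughput_count (T := T) (C := C) ?_ ?_
    · simpa [C] using this
    · intro c hc
      obtain ⟨a, rfl⟩ := (List.mem_ofFn' _ _).1 hc
      intro h
      have h0 : L a = [] := List.map_eq_nil_iff.1 h
      exact (F.isDipath a).1 (by rw [← hflat a, h0]; rfl)
    · intro c hc
      obtain ⟨a, rfl⟩ := (List.mem_ofFn' _ _).1 hc
      exact hchain a
  · intro v
    have hsub : List.Sublist ((Q.filter fun q => q.1 = v).map Prod.snd).flatten
        (Q.map Prod.snd).flatten := (List.filter_sublist.map _).flatten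
    have hmem : ∀ x, x ∈ ((Q.filter fun q => q.1 = v).map Prod.snd).flatten ↔
        x ∈ {x | col x = v} ∩ F.verts := by
      intro x
      have hF : x ∈ F.verts ↔ x ∈ (Q.map Prod.snd).flatten := by
        rw [hQF]; simp [KPathSubdigraph.verts]
      rw [Set.mem_inter_iff, hF]
      simp only [List.mem_flatten, List.mem_map, List.mem_filter, decide_eq_true_eq]
      constructor
      · rintro ⟨_, ⟨q, ⟨hq, rfl⟩, rfl⟩, hx⟩
        obtain ⟨a, ha⟩ := hQ q hq
        exact ⟨(hL a q ha).2.2 x hx, _, ⟨q, hq, rfl⟩, hx⟩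
      · rintro ⟨hv, _, ⟨q, hq, rfl⟩, hx⟩
        obtain ⟨a, ha⟩ := hQ q hq
        exact ⟨_, ⟨q, ⟨hq, ((hL a q ha).2.2 x hx).symm.trans hv⟩, rfl⟩, hx⟩
    refine ⟨(Q.filter fun q => q.1 = v).map Prod.snd, ⟨?_, hnodup.sublist hsub, ?_⟩, ?_, ?_⟩
    · intro l hl
      obtain ⟨q, hq, rfl⟩ := List.mem_map.1 hl
      have hq := List.mem_of_mem_filter hq
      obtain ⟨a, ha⟩ := hQ q hq
      exact ⟨(hL a q ha).1, (List.nodup_flatten.1 hnodup).1 _ (List.mem_map_of_mem hq),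
        (hL a q ha).2.1⟩
    · exact fun x hx => ((hmem x).1 hx).1
    · change _ = C.flatten.count v
      rw [hCQ, List.length_map, List.count_eq_countP, List.countP_map, List.countP_eq_length_filter]
      congr 1
    · rw [← ncard_setOf_mem_of_nodup (hnodup.sublist hsub)]
      congr 1
      ext x
      exact (hmem x).symm

/-! ### From throughput vectors to path subdigraphs -/

/-- The visits to `v` are replaced by the paths of the system `R v`, one for each visit. -/
theorem IsThroughput.exists_kPathSubdigraph {ι α : Type*} [Fintype ι] {T : Digraph ι}
    (hT : IsSemicomplete T) {D : Digraph α} {col : α → ι}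
    (hD : ∀ x y, col x ≠ col y → (D.Adj x y ↔ T.Adj (col x) (col y))) {k : ℕ} (hk : 1 ≤ k)
    {m : ι → ℕ} (hm : IsThroughput T k m) {R : ι → List (List α)}
    (hR : ∀ v, IsPathSystemIn D {x | col x = v} (R v)) (hlen : ∀ v, (R v).length = m v) :
    ∃ F : KPathSubdigraph D k, ∀ x, x ∈ F.verts ↔ x ∈ (R (col x)).flatten := by
  obtain ⟨f, hf, hreach⟩ := hm.exists_perm_reached hT hk
  obtain ⟨p, hp, hdisj, hcov⟩ := exists_lists_of_perm f hreach fun s s' he => by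
    have := hf (.inr s); rw [he] at this; exact this
  -- the path of `R v` that replaces a visit to `v`
  let piece : (Σ v, Fin (m v)) → List α := fun x => (R x.1)[x.2.1]'(by rw [hlen]; exact x.2.2)
  have hpmem : ∀ x, piece x ∈ R x.1 := fun x => List.getElem_mem _
  have hpcol : ∀ x, ∀ y ∈ piece x, col y = x.1 := fun x y hy =>
    (hR x.1).subset y (List.mem_flatten.2 ⟨_, hpmem x, hy⟩)
  have hpdisj : ∀ x y, x ≠ y → List.Disjoint (piece x) (piece y) := by
    rintro ⟨v, i⟩ ⟨w, j⟩ hne z hz hz'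
    obtain rfl : v = w := (hpcol _ z hz).symm.trans (hpcol _ z hz')
    have hij : i.1 ≠ j.1 := fun h => hne (by rw [Fin.ext h])
    have hpw := List.pairwise_iff_getElem.1 (List.nodup_flatten.1 (hR v).nodup).2
    rcases lt_or_gt_of_ne hij with h | h
    · exact hpw _ _ _ _ h hz hz'
    · exact hpw _ _ _ _ h hz' hz
  have hpd : ∀ x, IsDipath D (piece x) := fun x => (hR x.1).isDipath _ (hpmem x)
  refine ⟨⟨fun s => (p s).flatMap piece, fun s => ⟨?_, ?_, ?_⟩, ?_⟩, ?_⟩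
  · intro h0
    obtain ⟨x, hx⟩ := List.exists_mem_of_ne_nil _ (hp s).1
    exact (hpd x).1 (List.flatMap_eq_nil_iff.1 h0 x hx)
  · rw [List.nodup_flatMap]
    exact ⟨fun x _ => (hpd x).2.1, (hp s).2.1.imp fun {x y} hxy => hpdisj x y hxy⟩
  · rw [List.flatMap, List.isChain_flatten]
    · refine ⟨?_, ?_⟩
      · intro l hl
        obtain ⟨x, -, rfl⟩ := List.mem_map.1 hl
        exact (hpd x).2.2
      · rw [List.isChain_map]
        refine (hp s).2.2.imp fun x y hxy a ha b hb => ?_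
        have hstep := hf (.inl x)
        rw [hxy] at hstep
        have ha' := hpcol x a (List.mem_of_mem_getLast? ha)
        have hb' := hpcol y b (List.mem_of_mem_head? hb)
        rw [hD, ha', hb']
        · exact hstep.1
        · rw [ha', hb']; exact hstep.2
    · intro h
      obtain ⟨x, -, hx⟩ := List.mem_map.1 h
      exact (hpd x).1 hx
  · intro s s' hne z hz hz'
    obtain ⟨x, hx, hzx⟩ := List.mem_flatMap.1 hz
    obtain ⟨y, hy, hzy⟩ := List.mem_flatMap.1 hz'
    by_cases hxy : x = y
    · exact hdisj s s' hne hx (hxy ▸ hy)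
    · exact hpdisj x y hxy hzx hzy
  · intro z
    constructor
    · rintro ⟨s, hz⟩
      obtain ⟨x, -, hzx⟩ := List.mem_flatMap.1 hz
      rw [hpcol x z hzx]
      exact List.mem_flatten.2 ⟨_, hpmem x, hzx⟩
    · intro hz
      obtain ⟨l, hl, hzl⟩ := List.mem_flatten.1 hz
      obtain ⟨i, hi, rfl⟩ := List.getElem_of_mem hl
      obtain ⟨s, hs⟩ := hcov ⟨col z, i, by rw [← hlen]; exact hi⟩
      exact ⟨s, List.mem_flatMap.2 ⟨_, hs, hzl⟩⟩

theorem nonempty_kPathSubdigraph {α : Type*} [Fintype α] (D : Digraph α) {k : ℕ}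
    (hk : k ≤ Fintype.card α) : Nonempty (KPathSubdigraph D k) := by
  obtain ⟨e⟩ : Nonempty (Fin k ↪ α) :=
    Function.Embedding.nonempty_of_card_le (by simpa using hk)
  exact ⟨⟨fun a => [e a], fun a => ⟨by simp, by simp, by simp⟩, fun a b hab => by
    simpa using fun h => hab (e.injective h).symm⟩⟩

/-! ### The simultaneous maximum -/

theorem exists_greatest_isThroughput {ι : Type*} [Fintype ι] {T : Digraph ι}
    (hT : IsSemicomplete T) {k : ℕ} (a : ι → ℕ) (hne : ∃ m ≤ a, IsThroughput T k m) :
    ∃ M, IsGreatest {m | m ≤ a ∧ IsThroughput T k m} M := by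
  classical
  have hfin : {m | m ≤ a ∧ IsThroughput T k m}.Finite :=
    (Set.finite_Iic a).subset fun m hm => hm.1
  obtain ⟨M, hM⟩ := hfin.exists_maximal hne
  refine ⟨M, hM.prop, fun m hm => ?_⟩
  exact le_sup_right.trans
    (hM.le_of_ge ⟨sup_le hM.prop.1 hm.1, hM.prop.2.sup hT hm.2⟩ le_sup_left)

theorem exists_dominating_kPathSubdigraph {ι α : Type*} [Fintype ι] [Fintype α] {T : Digraph ι}
    (hT : IsSemicomplete T) {D : Digraph α} {col : α → ι}
    (hD : ∀ x y, col x ≠ col y → (D.Adj x y ↔ T.Adj (col x) (col y))) {k : ℕ} (hk : 1 ≤ k)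
    (hkn : k ≤ Fintype.card α) :
    ∃ F₀ : KPathSubdigraph D k, ∀ (F : KPathSubdigraph D k) (v : ι),
      ({x | col x = v} ∩ F.verts).ncard ≤ ({x | col x = v} ∩ F₀.verts).ncard := by
  have hfeas : ∀ F : KPathSubdigraph D k,
      ∃ m, (m ≤ (fun v => {x | col x = v}.ncard) ∧ IsThroughput T k m) ∧
        ∀ v, ∃ R, IsPathSystemIn D {x | col x = v} R ∧ R.length = m v ∧
          ({x | col x = v} ∩ F.verts).ncard = R.flatten.length := by
    intro F
    obtain ⟨m, hm, hR⟩ := F.exists_isThroughput hD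
    refine ⟨m, ⟨fun v => ?_, hm⟩, hR⟩
    obtain ⟨R, hR, hl, -⟩ := hR v
    rw [← hl]
    exact (length_le_length_flatten fun l hl => (hR.isDipath l hl).1).trans hR.length_flatten_le
  obtain ⟨F₁⟩ := nonempty_kPathSubdigraph D hkn
  obtain ⟨m₁, hm₁, -⟩ := hfeas F₁
  obtain ⟨M, ⟨hMa, hMT⟩, hMmax⟩ := exists_greatest_isThroughput hT _ ⟨m₁, hm₁⟩
  choose R hR hlen hopt using fun v => exists_optimal_pathSystemIn D {x | col x = v} (hMa v)
  obtain ⟨F₀, hF₀⟩ := hMT.exists_kPathSubdigraph hT hD hk hR hlen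
  refine ⟨F₀, fun F v => ?_⟩
  obtain ⟨m, hm, hRF⟩ := hfeas F
  obtain ⟨R', hR', hl', he⟩ := hRF v
  have hF₀v : {x | col x = v} ∩ F₀.verts = {x | x ∈ (R v).flatten} := by
    ext x
    rw [Set.mem_inter_iff, hF₀, Set.mem_ofPred_eq, Set.mem_ofPred_eq]
    constructor
    · rintro ⟨rfl, h⟩; exact h
    · intro h
      have hx : col x = v := (hR v).subset x h
      exact ⟨hx, hx.symm ▸ h⟩
  rw [he, hF₀v, ncard_setOf_mem_of_nodup (hR v).nodup]
  exact hopt v R' hR' (hl'.trans_le (hMmax hm v))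

theorem ncard_eq_sum_ncard_fiber {ι α : Type*} [Fintype ι] [Finite α] (col : α → ι)
    (S : Set α) : S.ncard = ∑ v, ({x | col x = v} ∩ S).ncard := by
  classical
  have := Fintype.ofFinite α
  rw [Set.ncard_eq_toFinset_card',
    Finset.card_eq_sum_card_fiberwise (f := col) (t := Finset.univ) (by simp)]
  refine Finset.sum_congr rfl fun v _ => ?_
  rw [← Set.ncard_coe_finset]
  congr 1
  ext x
  simp [and_comm]

theorem composition_adj_iff {ι : Type*} {V : ι → Type*} (T : Digraph ι) (H : ∀ i, Digraph (V i))
    (x y : Σ i, V i) (h : x.1 ≠ y.1) : (composition T H).Adj x y ↔ T.Adj x.1 y.1 := by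
  refine ⟨?_, Or.inr⟩
  rintro (⟨i, a, b, rfl, rfl, -⟩ | h')
  · exact absurd rfl h
  · exact h'

end SemicompleteComposition

theorem mainTheorem6 {ι : Type*} [Fintype ι] [Nontrivial ι]
    {V : ι → Type*} [∀ i, Fintype (V i)] [∀ i, Nonempty (V i)]
    (T : Digraph ι) (H : ∀ i, Digraph (V i))
    (hT : SemicompleteComposition.IsSemicomplete T)
    (hQ : SemicompleteComposition.IsStrong (SemicompleteComposition.composition T H))
    (k : ℕ) (hk : 1 ≤ k) (hkn : k ≤ Fintype.card (Σ i, V i)) (i : ι) :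
    ∃ n : ℕ,
      (∀ F : SemicompleteComposition.KPathSubdigraph
          (SemicompleteComposition.composition T H) k,
        F.IsMaximum → (SemicompleteComposition.part V i ∩ F.verts).ncard = n) ∧
      (∀ F : SemicompleteComposition.KPathSubdigraph
          (SemicompleteComposition.composition T H) k,
        (SemicompleteComposition.part V i ∩ F.verts).ncard ≤ n) ∧
      IsGreatest
        {m : ℕ | ∃ F : SemicompleteComposition.KPathSubdigraph
            (SemicompleteComposition.composition T H) k,
          (SemicompleteComposition.part V i ∩ F.verts).ncard = m} n := by
  obtain ⟨F₀, hF₀⟩ := SemicompleteComposition.exists_dominating_kPathSubdigraph hT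
    (SemicompleteComposition.composition_adj_iff T H) hk hkn
  refine ⟨_, fun F hF => ?_, fun F => hF₀ F i, ⟨F₀, rfl⟩, ?_⟩
  · have hle := hF F₀
    rw [SemicompleteComposition.ncard_eq_sum_ncard_fiber Sigma.fst F₀.verts,
      SemicompleteComposition.ncard_eq_sum_ncard_fiber Sigma.fst F.verts] at hle
    have hle' := Finset.sum_le_sum fun v (_ : v ∈ Finset.univ) => hF₀ F v
    exact (Finset.sum_eq_sum_iff_of_le fun v _ => hF₀ F v).1 (le_antisymm hle' hle) i
      (Finset.mem_univ i)
  · rintro _ ⟨F, rfl⟩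
    exact hF₀ F i
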